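/- Let $k\ge 2$ and let $\mathbf a=(a(n))_{n\ge 0}$ be a $k$-automatic sequence over a finite alphabet: there is a finite deterministic automaton with output such that $a(n)$ is the output of the last state reached on reading the base-$k$ representation $(n)_k$ (most significant digit first, without leading zeros, so $(0)_k$ is the empty word). For a nonempty word $v$ and a real $\tau\ge 1$ let $v^\tau$ be the shortest prefix of $vvv\cdots$ of length at least $\tau|v|$. The Diophantine exponent $\mathrm{Dio}(\mathbf a)$ of Adamczewski and Bugeaud is the supremum, in the extended reals, of the real numbers $\beta$ for which there are arbitrarily long prefixes of $\mathbf a$ of the form $uv^\tau$, with $u,v$ finite words, $v$ nonempty, $\tau\geq 1$ real, and $|uv^\tau|/|uv|\ge\beta$. Then: (1) $\mathrm{Dio}(\mathbf a)$ is either a rational number or $+\infty$. (2) Let $(m,n)_k$ be the canonical encoding of a pair of integers as a word over $\Sigma_k^2$, $\Sigma_k=\{0,\dots,k-1\}$ (base-$k$ representations, the shorter one padded with leading zeros to the length of the longer one), and let $$L_d=\{(i+\ell,\,i+p)_k : i\ge 0,\ \ell\ge p\ge 1,\ a(i+j)=a(i+p+j)\text{ for all } 0\le j<\ell-p\}.$$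 The language $L_d$ is regular, and $\mathrm{Dio}(\mathbf a)$ is the largest special point of $\mathrm{quo}_k(L_d)$. Here $\mathrm{quo}_k(x)$ is the quotient of the integers represented in base $k$ by the first and by the second components of the word $x$, and an extended real number $\beta$ is a special point of $\mathrm{quo}_k(L)$ if there is an infinite sequence $(x_j)$ of pairwise distinct words of $L$ with $\lim_j \mathrm{quo}_k(x_j)=\beta$. (3) $\mathrm{Dio}(\mathbf a)$ is computable: there is one algorithm (a total computable function) that, given $k\ge2$ and a finite automaton with output (as a transition table, an initial state and a list of outputs, the outputs being natural numbers) generating a $k$-automatic sequence $\mathbf a$, returns $\infty$ if $\mathrm{Dio}(\mathbf a)=\infty$, and otherwise natural numbers $p$ and $q>0$ with $\mathrm{Dio}(\mathbf a)=p/q$. -/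

import Mathlib

open Filter Topology

/-! ### Base-`k` words (most significant digit first) -/

/-- The `L` low-order base-`k` digits of `n`, most significant first
(padded with leading zeros when `n < k ^ L`). -/
def padDigits (k : ℕ) [NeZero k] (L n : ℕ) : List (Fin k) :=
  (List.range L).reverse.map fun j => Fin.ofNat k (n / k ^ j)

/-- The canonical encoding `(n)_k`: no leading zeros; `0` is encoded by the empty word. -/
def natWord (k : ℕ) [NeZero k] (n : ℕ) : List (Fin k) :=
  padDigits k (Nat.digits k n).length n

/-- The canonical encoding `(m, n)_k` of a pair: the shorter representation is padded with leading
zeros to the length of the longer one. -/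
def pairWord (k : ℕ) [NeZero k] (m n : ℕ) : List (Fin k × Fin k) :=
  (padDigits k (max (Nat.digits k m).length (Nat.digits k n).length) m).zip
    (padDigits k (max (Nat.digits k m).length (Nat.digits k n).length) n)

/-- `[w]_k`, the integer represented by the word `w` in base `k`. -/
def wordVal {k : ℕ} (w : List (Fin k)) : ℕ :=
  w.foldl (fun acc d => acc * k + d.val) 0

/-- `quo_k(x) = [π₁(x)]_k / [π₂(x)]_k`; meaningful when `[π₂(x)]_k ≠ 0`. -/
noncomputable def quo {k : ℕ} (x : List (Fin k × Fin k)) : ℝ :=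
  (wordVal (x.map Prod.fst) : ℝ) / (wordVal (x.map Prod.snd) : ℝ)

/-- The extended real `β` is a special point of `quo_k(L)`: the limit of `quo_k` along a sequence of
pairwise distinct words of `L` (with nonzero denominators, so that `quo_k` is defined on them). -/
def IsSpecialPoint {k : ℕ} (L : Language (Fin k × Fin k)) (β : EReal) : Prop :=
  ∃ x : ℕ → List (Fin k × Fin k), Function.Injective x ∧
    (∀ j, x j ∈ L ∧ wordVal ((x j).map Prod.snd) ≠ 0) ∧
    Tendsto (fun j => ((quo (x j) : ℝ) : EReal)) atTop (𝓝 β)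

/-! ### Automatic sequences -/

/-- A deterministic automaton with output over the digits `{0, …, k-1}`, with states `σ` and output
alphabet `Δ` (finiteness of `σ` is required where the structure is used). -/
structure DFAO (k : ℕ) (σ Δ : Type*) where
  /-- the transition function -/
  step : σ → Fin k → σ
  /-- the initial state -/
  start : σ
  /-- the output associated with each state -/
  out : σ → Δ

/-- The sequence generated by an automaton with output: read `(n)_k`, most significant digit first,
and output the label of the last state reached. -/
def DFAO.seq {k : ℕ} [NeZero k] {σ Δ : Type*} (M : DFAO k σ Δ) (n : ℕ) : Δ :=
  M.out ((natWord k n).foldl M.step M.start)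

/-- `a` is a `k`-automatic sequence. -/
def IsAutomatic (k : ℕ) [NeZero k] {Δ : Type*} (a : ℕ → Δ) : Prop :=
  ∃ (σ : Type) (_ : Fintype σ) (M : DFAO k σ Δ), M.seq = a

/-- The finite description of an automaton with output, as given to an algorithm: the base `k`, the
transition table (one row per state, one entry per digit), the initial state and the list of
outputs of the states. -/
def DFAO.code {k s : ℕ} (M : DFAO k (Fin s) ℕ) : ℕ × List (List ℕ) × ℕ × List ℕ :=
  (k, List.ofFn (fun q => List.ofFn fun d => (M.step q d).val), M.start.val, List.ofFn M.out)

/-! ### The Diophantine exponent -/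

/-- The prefix of length `n` of the infinite word `a`. -/
def prefixWord {Δ : Type*} (a : ℕ → Δ) (n : ℕ) : List Δ :=
  (List.range n).map a

/-- For a nonempty word `v` and a real `τ ≥ 1`, the power `v ^ τ`: the shortest prefix of
`v v v ⋯` of length at least `τ * |v|`. -/
noncomputable def realPow {Δ : Type*} (v : List Δ) (τ : ℝ) : List Δ :=
  (List.replicate ⌈τ⌉₊ v).flatten.take ⌈τ * v.length⌉₊

/-- There are arbitrarily long prefixes of `a` of the form `u v ^ τ` with
`|u v ^ τ| / |u v| ≥ β`. -/
def HasDioExponent {Δ : Type*} (a : ℕ → Δ) (β : ℝ) : Prop :=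
  ∀ N : ℕ, ∃ n ≥ N, ∃ (u v : List Δ) (τ : ℝ), v ≠ [] ∧ 1 ≤ τ ∧
    prefixWord a n = u ++ realPow v τ ∧
    β ≤ ((u ++ realPow v τ).length : ℝ) / ((u ++ v).length : ℝ)

/-- The Diophantine exponent of `a`, an extended real number. -/
noncomputable def Dio {Δ : Type*} (a : ℕ → Δ) : EReal :=
  sSup ((fun β : ℝ => (β : EReal)) '' {β : ℝ | HasDioExponent a β})

/-- The language `L_d` of all canonical encodings `(i + ℓ, i + p)_k` with `i ≥ 0`, `ℓ ≥ p ≥ 1`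
and `a[i .. i+ℓ-p-1] = a[i+p .. i+ℓ-1]`. -/
def dioLanguage (k : ℕ) [NeZero k] {Δ : Type*} (a : ℕ → Δ) : Language (Fin k × Fin k) :=
  {w | ∃ i ℓ p : ℕ, 1 ≤ p ∧ p ≤ ℓ ∧ (∀ j, j < ℓ - p → a (i + j) = a (i + p + j)) ∧
    w = pairWord k (i + ℓ) (i + p)}

/-- The extended real number denoted by the output of an algorithm: `none` stands for `∞` and
`some (p, q)`, with `q > 0`, for the rational number `p / q`. -/
def Denotes (o : Option (ℕ × ℕ)) (x : EReal) : Prop :=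
  (o = none ∧ x = ⊤) ∨ ∃ p q : ℕ, o = some (p, q) ∧ 0 < q ∧ x = (((p : ℝ) / (q : ℝ) : ℝ) : EReal)

/-! ### Sets of pairs of integers recognised by finitely many states -/

/-! A prefix u v^τ with |u v^τ| = m and |uv| = n amounts to `DioPair a m n`, so the exponent is the
limsup of m/n over these pairs as m → ∞ (`hasDioExponent_iff`). For an automatic sequence the pairs
are recognised by finitely many states: whether (k^L m₀ + r, k^L n₀ + t) is such a pair depends on
(m₀, n₀) only through a state from a finite set independent of L (`pairSystem_dioPair`). This also
gives regularity, by counting left quotients.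

The value comes from pumping. If two prefixes (m₀, n₀) and (m₀ + A, n₀ + B) of a pair share a state,
repeating the digits between them keeps B m - A n constant while m → ∞, so m/n tends to A/B, or to ∞
if B = 0 (`exists_pumped`). Conversely, a pair with large m contains a short loop, and removing it
subtracts k^i (A', B'). With A/B maximal among short loops, induction gives B m ≤ A n + B C for all
pairs (`mul_le_of_forall_loop`). Hence A/B is both the exponent and the largest special point.

For computability, A and B are at most C = k^(card S + 1), and card S is an explicit function of the
size of the automaton. A finite value is thus a fraction with denominator D = C!. It is at most p/D
exactly when D m ≤ p n + D C for all pairs, and a failure already shows below an explicit bound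
(`exists_bounded_violation`). -/

/-- The pairs of integers in `P` are classified by finitely many states `St m n`, and the state of
`(m, n)` determines which digit extensions of `(m, n)` belong to `P`. -/
structure PairSystem (k : ℕ) (P : ℕ → ℕ → Prop) {S : Type*} (St : ℕ → ℕ → S) : Prop where
  congr : ∀ {m n m' n' : ℕ}, St m n = St m' n' → ∀ {L r t : ℕ}, r < k ^ L → t < k ^ L →
    (P (k ^ L * m + r) (k ^ L * n + t) ↔ P (k ^ L * m' + r) (k ^ L * n' + t))
  pos : ∀ {m n : ℕ}, P m n → 1 ≤ n
  le : ∀ {m n : ℕ}, P m n → n ≤ m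
  diag : ∀ {n : ℕ}, 1 ≤ n → P n n

/-- Reading `l` further digits leads from `(m₀, n₀)` to `(m₀ + A, n₀ + B)` and back to the same
state, and some extension of `(m₀, n₀)` is in `P`. -/
structure IsLoop (k : ℕ) (P : ℕ → ℕ → Prop) {S : Type*} (St : ℕ → ℕ → S)
    (m₀ n₀ A B l : ℕ) : Prop where
  pos : 1 ≤ m₀
  len : 1 ≤ l
  divl : (m₀ + A) / k ^ l = m₀
  divr : (n₀ + B) / k ^ l = n₀
  state : St m₀ n₀ = St (m₀ + A) (n₀ + B)
  coacc : ∃ L u v, u < k ^ L ∧ v < k ^ L ∧ P (k ^ L * m₀ + u) (k ^ L * n₀ + v)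

/-- Pigeonhole on the `card S + 1` prefixes obtained by dropping between `E - card S` and `E`
digits. Starting the window this high keeps the prefixes short. -/
theorem exists_state_repetition (k : ℕ) {S : Type*} [Fintype S] (St : ℕ → ℕ → S) (m n E : ℕ)
    (hE : Fintype.card S ≤ E) :
    ∃ i j, i < j ∧ E - Fintype.card S ≤ i ∧ j ≤ E ∧
      St (m / k ^ i) (n / k ^ i) = St (m / k ^ j) (n / k ^ j) := by
  obtain ⟨x, y, hxy, h⟩ := Fintype.exists_ne_map_eq_of_card_lt
    (fun e : Fin (Fintype.card S + 1) =>
      St (m / k ^ (E - Fintype.card S + e.val)) (n / k ^ (E - Fintype.card S + e.val)))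
    (by simp)
  have hx := x.isLt
  have hy := y.isLt
  rcases lt_or_gt_of_ne (fun h => hxy (Fin.ext h) : x.val ≠ y.val) with hlt | hlt
  · exact ⟨_, _, Nat.add_lt_add_left hlt _, by omega, by omega, h⟩
  · exact ⟨_, _, Nat.add_lt_add_left hlt _, by omega, by omega, h.symm⟩

/-- The geometric sum `1 + K + ⋯ + K ^ (j - 1)`. -/
def geomSum (K j : ℕ) : ℕ := ∑ i ∈ Finset.range j, K ^ i

theorem geomSum_succ (K j : ℕ) : geomSum K (j + 1) = K * geomSum K j + 1 := by
  simp only [geomSum]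
  exact geom_sum_succ

theorem le_geomSum {K : ℕ} (hK : 1 ≤ K) (j : ℕ) : j ≤ geomSum K j := by
  induction j with
  | zero => simp
  | succ j ih =>
    rw [geomSum_succ]
    nlinarith

theorem geomSum_le {K : ℕ} (hK : 2 ≤ K) (j : ℕ) : geomSum K j + 1 ≤ K ^ j := by
  induction j with
  | zero => simp [geomSum]
  | succ j ih =>
    rw [geomSum_succ, pow_succ]
    nlinarith

theorem mul_pow_add_lt {k L l r u : ℕ} (hr : r < k ^ l) (hu : u < k ^ L) :
    k ^ L * r + u < k ^ (L + l) := by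
  rw [pow_add]
  calc k ^ L * r + u < k ^ L * r + k ^ L := by omega
    _ = k ^ L * (r + 1) := by ring
    _ ≤ _ := Nat.mul_le_mul_left _ hr

theorem exists_eq_mul_add_of_div_eq {k : ℕ} {m₀ A l : ℕ} (hk : 2 ≤ k) (h : (m₀ + A) / k ^ l = m₀) :
    ∃ r, r < k ^ l ∧ m₀ + A = k ^ l * m₀ + r := by
  refine ⟨(m₀ + A) % k ^ l, Nat.mod_lt _ (by positivity), ?_⟩
  have := Nat.div_add_mod (m₀ + A) (k ^ l)
  rw [h] at this
  exact this.symm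

theorem IsLoop.one_le {k : ℕ} {P : ℕ → ℕ → Prop} {S : Type*} {St : ℕ → ℕ → S}
    (hk : 2 ≤ k) {m₀ n₀ A B l : ℕ} (h : IsLoop k P St m₀ n₀ A B l) :
    1 ≤ A := by
  rcases Nat.eq_zero_or_pos A with h0 | h0
  · have h1 := h.divl
    rw [h0, Nat.add_zero] at h1
    have : m₀ / k ^ l < m₀ := Nat.div_lt_self h.pos
      (lt_of_lt_of_le (by omega) (Nat.le_self_pow (by have := h.len; omega) k))
    omega
  · exact h0

/-! ### Pumping and removing loops -/

namespace PairSystem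

variable {k : ℕ} {P : ℕ → ℕ → Prop} {S : Type*} {St : ℕ → ℕ → S}

/-- One turn of the loop is `x ↦ k ^ l * x + d`, so successive increments are multiplied by `k ^ l`
and add up to a geometric sum. In the induction the last turn is absorbed into the suffix, which is
why the suffix is universally quantified. -/
theorem pump_iff (hS : PairSystem k P St) (hk : 2 ≤ k) {m₀ n₀ A B l : ℕ}
    (h : IsLoop k P St m₀ n₀ A B l) (j : ℕ) : ∀ {L u v : ℕ}, u < k ^ L → v < k ^ L →
    (P (k ^ L * (m₀ + A * geomSum (k ^ l) j) + u) (k ^ L * (n₀ + B * geomSum (k ^ l) j) + v) ↔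
      P (k ^ L * m₀ + u) (k ^ L * n₀ + v)) := by
  obtain ⟨r, hr, hr'⟩ := exists_eq_mul_add_of_div_eq hk h.divl
  obtain ⟨t, ht, ht'⟩ := exists_eq_mul_add_of_div_eq hk h.divr
  induction j with
  | zero => intro L u v _ _; simp [geomSum]
  | succ j ih =>
    intro L u v hu hv
    have step : ∀ {x₀ X d s w G : ℕ}, x₀ + X = k ^ l * x₀ + d →
        k ^ L * (x₀ + X * (k ^ l * G + 1)) + w = k ^ (L + l) * (x₀ + X * G) + (k ^ L * d + w) := by
      intro x₀ X d s w G hd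
      rw [pow_add]
      calc _ = k ^ L * (x₀ + X) + k ^ L * (X * (k ^ l * G)) + w := by ring
        _ = _ := by rw [hd]; ring
    rw [geomSum_succ, step (s := 0) hr', step (s := 0) ht',
      ih (mul_pow_add_lt hr hu) (mul_pow_add_lt ht hv), hS.congr h.state hu hv]
    have e : ∀ x d w : ℕ, k ^ (L + l) * x + (k ^ L * d + w) = k ^ L * (k ^ l * x + d) + w := by
      intro x d w; rw [pow_add]; ring
    rw [e, e, hr', ht']

/-- An extension into `P` may be taken with at most as many digits as there are states. -/
theorem exists_short_coacc [Fintype S] (hS : PairSystem k P St) (hk : 2 ≤ k) {m₀ n₀ L u v : ℕ}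
    (hu : u < k ^ L) (hv : v < k ^ L) (h : P (k ^ L * m₀ + u) (k ^ L * n₀ + v)) :
    ∃ L u v, L ≤ Fintype.card S ∧ u < k ^ L ∧ v < k ^ L ∧
      P (k ^ L * m₀ + u) (k ^ L * n₀ + v) := by
  have hk0 : ∀ e, 0 < k ^ e := fun e => by positivity
  induction L using Nat.strong_induction_on generalizing u v with
  | _ L ih =>
    rcases le_or_gt L (Fintype.card S) with hL | hL
    · exact ⟨L, u, v, hL, hu, hv, h⟩
    -- Since `j ≤ L`, both repeated prefixes extend (m₀, n₀). Cutting out the digits between them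
    -- shortens the extension.
    · obtain ⟨i, j, hij, -, hj, hst⟩ :=
        exists_state_repetition k St (k ^ L * m₀ + u) (k ^ L * n₀ + v) L hL.le
      have e1 : ∀ x w : ℕ, (k ^ L * x + w) / k ^ j = k ^ (L - j) * x + w / k ^ j := by
        intro x w
        rw [← Nat.add_sub_cancel' hj, pow_add, mul_assoc, Nat.mul_add_div (hk0 j),
          Nat.add_sub_cancel' hj]
      have e2 : ∀ x d w : ℕ, k ^ i * (k ^ (L - j) * x + d) + w
          = k ^ (i + (L - j)) * x + (k ^ i * d + w) := by
        intro x d w; rw [pow_add]; ring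
      have hlt : ∀ {w}, w < k ^ L → w / k ^ j < k ^ (L - j) := by
        intro w hw
        rw [Nat.div_lt_iff_lt_mul (hk0 j), ← pow_add, Nat.sub_add_cancel hj]
        exact hw
      rw [← Nat.div_add_mod (k ^ L * m₀ + u) (k ^ i), ← Nat.div_add_mod (k ^ L * n₀ + v) (k ^ i),
        hS.congr hst (Nat.mod_lt _ (hk0 i)) (Nat.mod_lt _ (hk0 i)), e1, e1, e2, e2] at h
      exact ih (i + (L - j)) (by omega)
        (mul_pow_add_lt (hlt hu) (Nat.mod_lt _ (hk0 i)))
        (mul_pow_add_lt (hlt hv) (Nat.mod_lt _ (hk0 i))) h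

/-- A large pair in `P` contains a short loop, and the loop can be removed. -/
theorem exists_loop [Fintype S] (hS : PairSystem k P St) (hk : 2 ≤ k) {m n : ℕ} (h : P m n)
    (hm : k ^ Fintype.card S ≤ m) :
    ∃ m₀ n₀ A B l i u v, IsLoop k P St m₀ n₀ A B l ∧ m₀ + A < k ^ (Fintype.card S + 1) ∧
      P (k ^ i * m₀ + u) (k ^ i * n₀ + v) ∧ m = k ^ i * (m₀ + A) + u ∧
      n = k ^ i * (n₀ + B) + v := by
  have hk0 : ∀ e, 0 < k ^ e := fun e => by positivity
  have hm0 : m ≠ 0 := by have := hk0 (Fintype.card S); omega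
  -- The window keeps between 1 and `card S + 1` leading digits of `m`: the shorter prefix is
  -- positive, the longer one is below `k ^ (card S + 1)`.
  set E := Nat.log k m with hEdef
  have hE1 : k ^ E ≤ m := Nat.pow_log_le_self k hm0
  have hE2 : m < k ^ (E + 1) := Nat.lt_pow_succ_log_self (by omega) m
  have hE : Fintype.card S ≤ E := (Nat.le_log_iff_pow_le (by omega) hm0).2 hm
  obtain ⟨i, j, hij, hi, hj, hst⟩ := exists_state_repetition k St m n E hE
  have hji : ∀ x : ℕ, x / k ^ i / k ^ (j - i) = x / k ^ j := by
    intro x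
    rw [Nat.div_div_eq_div_mul, ← pow_add, Nat.add_sub_cancel' hij.le]
  have hle : ∀ x : ℕ, x / k ^ j ≤ x / k ^ i := fun x => by
    rw [← hji x]; exact Nat.div_le_self _ _
  have hd := Nat.div_add_mod m (k ^ i)
  have hd' := Nat.div_add_mod n (k ^ i)
  have hP : P (k ^ i * (m / k ^ j) + m % k ^ i) (k ^ i * (n / k ^ j) + n % k ^ i) := by
    rw [← hS.congr hst (Nat.mod_lt _ (hk0 i)) (Nat.mod_lt _ (hk0 i)), hd, hd']
    exact h
  refine ⟨m / k ^ j, n / k ^ j, m / k ^ i - m / k ^ j, n / k ^ i - n / k ^ j, j - i, i,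
    m % k ^ i, n % k ^ i, ⟨?_, by omega, ?_, ?_, ?_, i, _, _, Nat.mod_lt _ (hk0 i),
      Nat.mod_lt _ (hk0 i), hP⟩, ?_, hP, ?_, ?_⟩
  · rw [Nat.one_le_div_iff (hk0 j)]
    exact (Nat.pow_le_pow_right (by omega) hj).trans hE1
  · rw [Nat.add_sub_cancel' (hle m), hji]
  · rw [Nat.add_sub_cancel' (hle n), hji]
  · rw [Nat.add_sub_cancel' (hle m), Nat.add_sub_cancel' (hle n), hst]
  · rw [Nat.add_sub_cancel' (hle m), Nat.div_lt_iff_lt_mul (hk0 i), ← pow_add]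
    exact hE2.trans_le (Nat.pow_le_pow_right (by omega) (by omega))
  · rw [Nat.add_sub_cancel' (hle m), hd]
  · rw [Nat.add_sub_cancel' (hle n), hd']

/-- If the second component of a prefix were larger, no suffix could make up for it. This bounds `B`
by the bound for `m₀ + A`. -/
theorem loop_le (hS : PairSystem k P St) {m₀ n₀ A B l : ℕ}
    (h : IsLoop k P St m₀ n₀ A B l) : n₀ + B ≤ m₀ + A := by
  obtain ⟨L, u, v, hu, hv, hP⟩ := h.coacc
  have h1 := hS.le ((hS.congr h.state hu hv).1 hP)
  by_contra hc
  have : k ^ L * (m₀ + A + 1) ≤ k ^ L * (n₀ + B) := Nat.mul_le_mul_left _ (by omega)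
  rw [Nat.mul_add_one] at this
  omega

/-- Removing a short loop changes `B * m - A * n` by `-k ^ i * (B * A' - A * B')`, so never
decreases it. The additive constant pays for the pairs too small to contain a loop. -/
theorem mul_le_of_forall_loop [Fintype S] (hS : PairSystem k P St) (hk : 2 ≤ k) {A B : ℕ}
    (hmax : ∀ m₀ n₀ A' B' l, IsLoop k P St m₀ n₀ A' B' l →
      m₀ + A' < k ^ (Fintype.card S + 1) → B * A' ≤ A * B') {m n : ℕ} (h : P m n) :
    B * m ≤ A * n + B * k ^ (Fintype.card S + 1) := by
  induction m using Nat.strong_induction_on generalizing n with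
  | _ m ih =>
    rcases lt_or_ge m (k ^ Fintype.card S) with hm | hm
    · have : m ≤ k ^ (Fintype.card S + 1) :=
        hm.le.trans (Nat.pow_le_pow_right (by omega) (by omega))
      exact (Nat.mul_le_mul_left B this).trans (Nat.le_add_left _ _)
    · obtain ⟨m₀, n₀, A', B', l, i, u, v, hl, hs, hP, rfl, rfl⟩ := hS.exists_loop hk h hm
      have h1 : 1 ≤ A' := hl.one_le hk
      have h2 : 0 < k ^ i := by positivity
      have h3 := ih (k ^ i * m₀ + u) (by nlinarith) hP
      have h4 := Nat.mul_le_mul_left (k ^ i) (hmax _ _ _ _ _ hl hs)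
      nlinarith

/-- There is a short loop whose ratio `A / B` is maximal among the short loops. -/
theorem exists_max_loop [Fintype S] (hS : PairSystem k P St) (hk : 2 ≤ k) :
    ∃ m₀ n₀ A B l, IsLoop k P St m₀ n₀ A B l ∧ m₀ + A < k ^ (Fintype.card S + 1) ∧
      ∀ m₀' n₀' A' B' l', IsLoop k P St m₀' n₀' A' B' l' →
        m₀' + A' < k ^ (Fintype.card S + 1) → B * A' ≤ A * B' := by
  -- A loop with `B = 0` has infinite ratio, and the cross-multiplied inequality is then trivial.
  by_cases h0 : ∃ m₀ n₀ A l, IsLoop k P St m₀ n₀ A 0 l ∧ m₀ + A < k ^ (Fintype.card S + 1)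
  · obtain ⟨m₀, n₀, A, l, h, hs⟩ := h0
    exact ⟨m₀, n₀, A, 0, l, h, hs, by simp⟩
  · set C := k ^ (Fintype.card S + 1)
    let T : Set (ℕ × ℕ) := {x | ∃ m₀ n₀ l, IsLoop k P St m₀ n₀ x.1 x.2 l ∧ m₀ + x.1 < C}
    have hfin : T.Finite := by
      refine ((Set.finite_Iio C).prod (Set.finite_Iio C)).subset ?_
      rintro ⟨A, B⟩ ⟨m₀, n₀, l, h, hs⟩
      have := hS.loop_le h
      simp only [Set.mem_prod, Set.mem_Iio]
      simp only at hs
      omega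
    have hne : T.Nonempty := by
      obtain ⟨m₀, n₀, A, B, l, i, u, v, hl, hs, -⟩ := hS.exists_loop hk
        (hS.diag (n := k ^ Fintype.card S) (Nat.one_le_pow _ _ (by omega))) le_rfl
      exact ⟨(A, B), m₀, n₀, l, hl, hs⟩
    obtain ⟨⟨A, B⟩, ⟨m₀, n₀, l, hl, hs⟩, hmax⟩ :=
      Set.exists_max_image T (fun x => (x.1 : ℚ) / x.2) hfin hne
    refine ⟨m₀, n₀, A, B, l, hl, hs, fun m₀' n₀' A' B' l' hl' hs' => ?_⟩
    have h1 := hmax (A', B') ⟨m₀', n₀', l', hl', hs'⟩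
    have hB : 0 < B := Nat.pos_of_ne_zero (by rintro rfl; exact h0 ⟨_, _, _, _, hl, hs⟩)
    have hB' : 0 < B' := Nat.pos_of_ne_zero (by rintro rfl; exact h0 ⟨_, _, _, _, hl', hs'⟩)
    rw [div_le_div_iff₀ (by exact_mod_cast hB') (by exact_mod_cast hB)] at h1
    have h2 : A' * B ≤ A * B' := by exact_mod_cast h1
    linarith

/-- Pumping a loop. -/
theorem exists_pumped (hS : PairSystem k P St) (hk : 2 ≤ k) {m₀ n₀ A B l : ℕ}
    (h : IsLoop k P St m₀ n₀ A B l) :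
    ∃ c : ℤ, ∀ J : ℕ, ∃ m n : ℕ, J ≤ m ∧ P m n ∧ (B : ℤ) * m - A * n = c := by
  obtain ⟨L, u, v, hu, hv, hP⟩ := h.coacc
  have h1 : 1 ≤ A := h.one_le hk
  refine ⟨B * (k ^ L * m₀ + u) - A * (k ^ L * n₀ + v), fun J =>
    ⟨_, _, ?_, (hS.pump_iff hk h J hu hv).2 hP, ?_⟩⟩
  · have h2 : J ≤ geomSum (k ^ l) J := le_geomSum (Nat.one_le_pow _ _ (by omega)) J
    have h3 : 1 ≤ k ^ L := Nat.one_le_pow _ _ (by omega)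
    calc J ≤ 1 * (A * geomSum (k ^ l) J) := by nlinarith
      _ ≤ k ^ L * (m₀ + A * geomSum (k ^ l) J) := Nat.mul_le_mul h3 (by omega)
      _ ≤ _ := Nat.le_add_right _ _
  · push_cast
    ring

/-- A bound, in terms of `C`, for a pair that violates `q * m ≤ p * n + q * C`. -/
def searchBound (C p q : ℕ) : ℕ := C * (C + C * C ^ (p * C + q * C + 1)) + C

/-- Each pumping step gains, since `q * A - p * B ≥ 1`. A geometric sum of at least `p * C + q * C +
1` outweighs `p * (n₀ + 1)`, which covers the prefix and suffix of `n`, and still leaves more than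
`q * C`. A short suffix keeps `m` bounded. -/
theorem exists_bounded_violation [Fintype S] (hS : PairSystem k P St) (hk : 2 ≤ k)
    {m₀ n₀ A B l p q : ℕ} (h : IsLoop k P St m₀ n₀ A B l)
    (hs : m₀ + A < k ^ (Fintype.card S + 1)) (hlt : p * B < q * A) :
    ∃ m n, P m n ∧ m < searchBound (k ^ (Fintype.card S + 1)) p q ∧
      p * n + q * k ^ (Fintype.card S + 1) < q * m := by
  obtain ⟨L₁, u₁, v₁, hu₁, hv₁, hP₁⟩ := h.coacc
  obtain ⟨L, u, v, hL, hu, hv, hP⟩ := hS.exists_short_coacc hk hu₁ hv₁ hP₁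
  have hLC : k ^ L ≤ k ^ (Fintype.card S + 1) := Nat.pow_le_pow_right (by omega) (by omega)
  set C := k ^ (Fintype.card S + 1)
  set j := p * C + q * C + 1 with hj
  have hA : 1 ≤ A := h.one_le hk
  have hle := hS.loop_le h
  have hkl : k ^ l ≤ m₀ + A := by
    by_contra hc
    have := h.divl
    rw [Nat.div_eq_of_lt (by omega)] at this
    have := h.pos
    omega
  have hk2 : 2 ≤ k ^ l := hk.trans (Nat.le_self_pow (by have := h.len; omega) k)
  have hG1 : j ≤ geomSum (k ^ l) j := le_geomSum (by omega) j
  have hG2 : geomSum (k ^ l) j ≤ C ^ j := by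
    have := geomSum_le hk2 j
    have := Nat.pow_le_pow_left (hkl.trans hs.le) j
    omega
  refine ⟨_, _, (hS.pump_iff hk h j hu hv).2 hP, ?_, ?_⟩
  · rw [searchBound, ← hj]
    have h1 : A * geomSum (k ^ l) j ≤ C * C ^ j := Nat.mul_le_mul (by omega) hG2
    have h2 : k ^ L * (m₀ + A * geomSum (k ^ l) j) ≤ C * (C + C * C ^ j) :=
      Nat.mul_le_mul hLC (by omega)
    omega
  · set G := geomSum (k ^ l) j
    have hkL : 1 ≤ k ^ L := Nat.one_le_pow _ _ (by omega)
    have h1 : p * (n₀ + 1) ≤ p * C := Nat.mul_le_mul_left _ (by omega)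
    have h2 : (p * B + 1) * G ≤ q * A * G := Nat.mul_le_mul_right _ hlt
    have h3 : p * v ≤ p * k ^ L := Nat.mul_le_mul_left _ hv.le
    have h4 : p * C + q * C + 1 ≤ G := hG1
    have h5 : p * (n₀ + 1) + q * C + 1 + p * B * G ≤ q * A * G := by nlinarith
    have h6 := Nat.mul_le_mul_left (k ^ L) h5
    have h7 : q * C + 1 ≤ k ^ L * (q * C + 1) := Nat.le_mul_of_pos_left _ hkL
    have h8 : 0 ≤ q * (k ^ L * m₀) := Nat.zero_le _
    have h9 : 0 ≤ q * u := Nat.zero_le _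
    nlinarith

end PairSystem

/-! ### The Diophantine exponent and pairs of integers -/

/-- The integer pairs `(i + ℓ, i + p)` encoded by the words of `L_d`. -/
def DioPair {Δ : Type*} (a : ℕ → Δ) (m n : ℕ) : Prop :=
  n ≤ m ∧ ∃ i < n, ∀ j < m - n, a (i + j) = a (n + j)

theorem DioPair.pos {Δ : Type*} {a : ℕ → Δ} {m n : ℕ} (h : DioPair a m n) : 1 ≤ n := by
  obtain ⟨-, i, hi, -⟩ := h
  omega

theorem DioPair.diag {Δ : Type*} (a : ℕ → Δ) {n : ℕ} (h : 1 ≤ n) : DioPair a n n :=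
  ⟨le_rfl, 0, h, by simp⟩

theorem mem_dioLanguage_iff {k : ℕ} [NeZero k] {Δ : Type*} {a : ℕ → Δ}
    {w : List (Fin k × Fin k)} :
    w ∈ dioLanguage k a ↔ ∃ m n, DioPair a m n ∧ w = pairWord k m n := by
  constructor
  · rintro ⟨i, ℓ, p, hp, hpl, h, rfl⟩
    exact ⟨i + ℓ, i + p, ⟨by omega, i, by omega, fun j hj => h j (by omega)⟩, rfl⟩
  · rintro ⟨m, n, ⟨hnm, i, hi, h⟩, rfl⟩
    refine ⟨i, m - i, n - i, by omega, by omega, fun j hj => ?_, ?_⟩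
    · rw [h j (by omega)]
      congr 1
      omega
    · rw [Nat.add_sub_cancel' hi.le, Nat.add_sub_cancel' (hi.le.trans hnm)]

theorem flatten_replicate_getElem? {Δ : Type*} (v : List Δ) {c j : ℕ} (h : j < c * v.length) :
    (List.replicate c v).flatten[j]? = v[j % v.length]? := by
  induction c generalizing j with
  | zero => simp at h
  | succ c ih =>
    rw [List.replicate_succ, List.flatten_cons]
    rcases lt_or_ge j v.length with hj | hj
    · rw [List.getElem?_append_left hj, Nat.mod_eq_of_lt hj]
    · rw [List.getElem?_append_right hj, ih (by rw [Nat.succ_mul] at h; omega),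
        ← Nat.mod_eq_sub_mod hj]

theorem ceil_mul_length_le {Δ : Type*} (v : List Δ) (τ : ℝ) :
    ⌈τ * v.length⌉₊ ≤ ⌈τ⌉₊ * v.length := by
  rw [Nat.ceil_le]
  push_cast
  exact mul_le_mul_of_nonneg_right (Nat.le_ceil τ) (Nat.cast_nonneg _)

theorem length_realPow {Δ : Type*} (v : List Δ) (τ : ℝ) :
    (realPow v τ).length = ⌈τ * v.length⌉₊ := by
  rw [realPow, List.length_take, min_eq_left]
  simpa using ceil_mul_length_le v τ

theorem realPow_getElem? {Δ : Type*} (v : List Δ) (τ : ℝ) {j : ℕ} (h : j < ⌈τ * v.length⌉₊) :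
    (realPow v τ)[j]? = v[j % v.length]? := by
  rw [realPow, List.getElem?_take_of_lt h,
    flatten_replicate_getElem? v (h.trans_le (ceil_mul_length_le v τ))]

theorem prefixWord_getElem? {Δ : Type*} (a : ℕ → Δ) {n j : ℕ} (h : j < n) :
    (prefixWord a n)[j]? = some (a j) := by
  simp [prefixWord, h]

theorem hasDioExponent_iff {Δ : Type*} (a : ℕ → Δ) (β : ℝ) :
    HasDioExponent a β ↔ ∀ N : ℕ, ∃ m ≥ N, ∃ n, DioPair a m n ∧ β ≤ (m : ℝ) / n := by
  refine forall_congr' fun N => ⟨?_, ?_⟩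
  · rintro ⟨m, hm, u, v, τ, hv, hτ, h, hβ⟩
    have hv0 : 0 < v.length := List.length_pos_iff.2 hv
    have hlen : m = u.length + ⌈τ * v.length⌉₊ := by
      have := congrArg List.length h
      simpa [prefixWord, length_realPow] using this
    have hle : v.length ≤ ⌈τ * v.length⌉₊ := by
      have : (v.length : ℝ) ≤ ⌈τ * v.length⌉₊ :=
        le_trans (le_mul_of_one_le_left (Nat.cast_nonneg _) hτ) (Nat.le_ceil _)
      exact_mod_cast this
    have ha : ∀ j < ⌈τ * v.length⌉₊, some (a (u.length + j)) = v[j % v.length]? := by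
      intro j hj
      rw [← realPow_getElem? v τ hj, ← prefixWord_getElem? a (n := m) (by omega), h,
        List.getElem?_append_right (by omega), Nat.add_sub_cancel_left]
    refine ⟨m, hm, u.length + v.length, ⟨by omega, u.length, by omega, fun j hj => ?_⟩, ?_⟩
    · apply Option.some_injective
      rw [ha j (by omega), add_assoc, ha (v.length + j) (by omega), Nat.add_mod_left]
    · simpa [length_realPow, hlen] using hβ
  · rintro ⟨m, hm, n, ⟨hnm, i, hi, h⟩, hβ⟩
    set v := (List.range (n - i)).map fun j => a (i + j) with hvdef
    have hv : v.length = n - i := by simp [hvdef]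
    have hp : 0 < n - i := by omega
    have hp' : (0 : ℝ) < ((n - i : ℕ) : ℝ) := by exact_mod_cast hp
    have hlen : ⌈((m - i : ℕ) : ℝ) / ((n - i : ℕ) : ℝ) * v.length⌉₊ = m - i := by
      rw [hv, div_mul_cancel₀ _ hp'.ne', Nat.ceil_natCast]
    have hper : ∀ j < m - i, a (i + j) = a (i + j % (n - i)) := by
      intro j
      induction j using Nat.strong_induction_on with
      | _ j ih =>
        intro hj
        rcases lt_or_ge j (n - i) with hjp | hjp
        · rw [Nat.mod_eq_of_lt hjp]
        · rw [Nat.mod_eq_sub_mod hjp, ← ih (j - (n - i)) (by omega) (by omega),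
            h (j - (n - i)) (by omega)]
          congr 1
          omega
    -- This `τ` makes `τ * |v|` the integer `m - i`, so the ceiling in `realPow` adds nothing.
    refine ⟨m, hm, prefixWord a i, v, ((m - i : ℕ) : ℝ) / ((n - i : ℕ) : ℝ), ?_, ?_, ?_, ?_⟩
    · rw [← List.length_pos_iff]
      omega
    · rw [one_le_div hp']
      exact_mod_cast (by omega : n - i ≤ m - i)
    · have hl : (prefixWord a i).length = i := by simp [prefixWord]
      refine List.ext_getElem? fun j => ?_
      rcases lt_or_ge j m with hj | hj
      · rw [prefixWord_getElem? a hj]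
        rcases lt_or_ge j i with hji | hji
        · rw [List.getElem?_append_left (by omega), prefixWord_getElem? a hji]
        · rw [List.getElem?_append_right (by omega), hl, realPow_getElem? _ _ (by omega), hv]
          have := hper (j - i) (by omega)
          rw [Nat.add_sub_cancel' hji] at this
          rw [this]
          simp [hvdef, Nat.mod_lt _ hp]
      · rw [List.getElem?_eq_none (by simpa [prefixWord] using hj), List.getElem?_eq_none]
        rw [List.length_append, length_realPow, hlen, hl]
        omega
    · rw [List.length_append, List.length_append, length_realPow, hlen, hv]
      have hl : (prefixWord a i).length = i := by simp [prefixWord]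
      rw [hl, Nat.add_sub_cancel' hi.le, Nat.add_sub_cancel' (hi.le.trans hnm)]
      exact hβ

/-! ### Base-`k` words -/

section Words

variable {k : ℕ} [NeZero k]

theorem padDigits_succ (L n : ℕ) :
    padDigits k (L + 1) n = padDigits k L (n / k) ++ [Fin.ofNat k n] := by
  simp only [padDigits, List.range_succ_eq_map, List.reverse_cons, List.map_append,
    List.map_reverse, List.map_map, List.map_cons, List.map_nil, pow_zero, Nat.div_one]
  congr 3
  funext j
  simp [Nat.div_div_eq_div_mul, pow_succ']

theorem length_padDigits (L n : ℕ) : (padDigits k L n).length = L := by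
  simp [padDigits]

theorem wordVal_append {k : ℕ} (w w' : List (Fin k)) :
    wordVal (w ++ w') = wordVal w * k ^ w'.length + wordVal w' := by
  induction w' using List.reverseRecOn with
  | nil => simp [wordVal]
  | append_singleton w' d ih =>
    have h : ∀ x : List (Fin k), wordVal (x ++ [d]) = wordVal x * k + d.val := by
      intro x; simp [wordVal]
    rw [← List.append_assoc, h, ih, h, List.length_append, List.length_singleton, pow_succ]
    ring

theorem wordVal_padDigits (L n : ℕ) (h : n < k ^ L) : wordVal (padDigits k L n) = n := by
  induction L generalizing n with
  | zero => simp_all [padDigits, wordVal]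
  | succ L ih =>
    have hk : 0 < k := Nat.pos_of_ne_zero (NeZero.ne k)
    rw [padDigits_succ, wordVal_append, ih (n / k)
      (by rw [Nat.div_lt_iff_lt_mul hk, ← pow_succ]; exact h)]
    have : wordVal [Fin.ofNat k n] = n % k := by simp [wordVal]
    rw [this, List.length_singleton, pow_one, mul_comm]
    exact Nat.div_add_mod n k

theorem wordVal_lt {k : ℕ} (w : List (Fin k)) : wordVal w < k ^ w.length := by
  induction w using List.reverseRecOn with
  | nil => simp [wordVal]
  | append_singleton w d ih =>
    have h : wordVal (w ++ [d]) = wordVal w * k + d.val := by simp [wordVal]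
    rw [h, List.length_append, List.length_singleton, pow_succ]
    have := d.isLt
    calc wordVal w * k + d.val < wordVal w * k + k := by omega
      _ = (wordVal w + 1) * k := by ring
      _ ≤ _ := Nat.mul_le_mul_right _ ih

theorem padDigits_wordVal (w : List (Fin k)) : padDigits k w.length (wordVal w) = w := by
  induction w using List.reverseRecOn with
  | nil => simp [padDigits]
  | append_singleton w d ih =>
    have h : wordVal (w ++ [d]) = d.val + k * wordVal w := by
      simp only [wordVal, List.foldl_append, List.foldl_cons, List.foldl_nil]
      ring
    rw [List.length_append, List.length_singleton, padDigits_succ, h,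
      Nat.add_mul_div_left _ _ (Nat.pos_of_ne_zero (NeZero.ne k)), Nat.div_eq_of_lt d.isLt,
      Nat.zero_add, ih]
    congr 2
    apply Fin.ext
    simp [Nat.mod_eq_of_lt d.isLt]

theorem map_fst_pairWord (m n : ℕ) : (pairWord k m n).map Prod.fst =
    padDigits k (max (Nat.digits k m).length (Nat.digits k n).length) m := by
  rw [pairWord, List.map_fst_zip (by simp [length_padDigits])]

theorem map_snd_pairWord (m n : ℕ) : (pairWord k m n).map Prod.snd =
    padDigits k (max (Nat.digits k m).length (Nat.digits k n).length) n := by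
  rw [pairWord, List.map_snd_zip (by simp [length_padDigits])]

theorem wordVal_fst_pairWord (hk : 2 ≤ k) (m n : ℕ) :
    wordVal ((pairWord k m n).map Prod.fst) = m := by
  rw [map_fst_pairWord, wordVal_padDigits _ _ ((Nat.lt_base_pow_length_digits (m := m) hk).trans_le
    (Nat.pow_le_pow_right (by omega) (le_max_left _ _)))]

theorem wordVal_snd_pairWord (hk : 2 ≤ k) (m n : ℕ) :
    wordVal ((pairWord k m n).map Prod.snd) = n := by
  rw [map_snd_pairWord, wordVal_padDigits _ _ ((Nat.lt_base_pow_length_digits (m := n) hk).trans_le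
    (Nat.pow_le_pow_right (by omega) (le_max_right _ _)))]

theorem quo_pairWord (hk : 2 ≤ k) (m n : ℕ) : quo (pairWord k m n) = (m : ℝ) / n := by
  rw [quo, wordVal_fst_pairWord hk, wordVal_snd_pairWord hk]

end Words

/-! ### The value of the exponent -/

/-- `A / B` as an extended real, `⊤` when `B = 0`. -/
noncomputable def ratioOrTop (A B : ℕ) : EReal :=
  if B = 0 then ⊤ else (((A : ℝ) / (B : ℝ) : ℝ) : EReal)

section Value

variable {Δ : Type*} {a : ℕ → Δ} {A B C : ℕ}

/-- If `B = 0`, the relation fixes `n` while `m` grows. Otherwise `m / n = A / B + c / (B * n)` with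
`n → ∞`. -/
theorem exists_tendsto_ratioOrTop (hA : 1 ≤ A)
    (hlow : ∃ c : ℤ, ∀ J : ℕ, ∃ m n : ℕ, J ≤ m ∧ DioPair a m n ∧ (B : ℤ) * m - A * n = c) :
    ∃ μ ν : ℕ → ℕ, StrictMono μ ∧ (∀ j, DioPair a (μ j) (ν j)) ∧
      Tendsto (fun j => (((μ j : ℝ) / (ν j : ℝ) : ℝ) : EReal)) atTop (𝓝 (ratioOrTop A B)) := by
  obtain ⟨c, hc⟩ := hlow
  obtain ⟨μ, hμ, h⟩ := extraction_of_frequently_atTop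
    (P := fun m => ∃ n : ℕ, DioPair a m n ∧ (B : ℤ) * m - A * n = c)
    (by
      rw [frequently_atTop]
      intro J
      obtain ⟨m, n, hJ, hP, he⟩ := hc J
      exact ⟨m, hJ, n, hP, he⟩)
  choose ν hP he using h
  refine ⟨μ, ν, hμ, hP, ?_⟩
  have hμ' : Tendsto (fun j => (μ j : ℝ)) atTop atTop :=
    tendsto_natCast_atTop_atTop.comp hμ.tendsto_atTop
  have hν1 : ∀ j, 0 < (ν j : ℝ) := fun j => by exact_mod_cast (hP j).pos
  have he' : ∀ j, (B : ℝ) * μ j - A * ν j = c := fun j => by exact_mod_cast he j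
  have hA' : (0 : ℝ) < A := by exact_mod_cast hA
  rcases Nat.eq_zero_or_pos B with hB | hB
  · rw [ratioOrTop, if_pos hB, EReal.tendsto_coe_nhds_top_iff]
    have hν : ∀ j, (ν j : ℝ) = -c / A := by
      intro j
      have := he' j
      rw [hB] at this
      field_simp
      push_cast at this
      linarith
    have h0 : (0 : ℝ) < -c / A := hν 0 ▸ hν1 0
    simp only [hν]
    exact hμ'.atTop_div_const h0
  · rw [ratioOrTop, if_neg hB.ne', EReal.tendsto_coe]
    have hB' : (0 : ℝ) < B := by exact_mod_cast hB
    have hν : Tendsto (fun j => (B : ℝ) * ν j) atTop atTop := by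
      have h1 : ∀ j, (B : ℝ) * ν j = (B / A) * (B * μ j - c) := by
        intro j
        field_simp
        linarith [he' j]
      simp only [h1]
      exact (tendsto_atTop_add_const_right _ (-(c : ℝ)) (hμ'.const_mul_atTop hB')).const_mul_atTop
        (by positivity)
    have h2 : ∀ j, (μ j : ℝ) / ν j = A / B + c / (B * ν j) := by
      intro j
      have := hν1 j
      field_simp
      linarith [he' j]
    simp only [h2]
    simpa using tendsto_const_nhds.add (hν.const_div_atTop (c : ℝ))

/-- With `ρ = A / B`, the inequalities `γ * n ≤ m ≤ ρ * n + C` force `n ≤ C / (γ - ρ)`, and this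
bounds `m`. -/
theorem exists_forall_le_of_ratioOrTop_lt
    (hup : ∀ m n, DioPair a m n → B * m ≤ A * n + B * C) {γ : ℝ}
    (hγ : ratioOrTop A B < (γ : EReal)) :
    ∃ K : ℕ, ∀ m n, DioPair a m n → γ ≤ (m : ℝ) / n → m ≤ K := by
  rcases Nat.eq_zero_or_pos B with hB | hB
  · simp [ratioOrTop, hB] at hγ
  · rw [ratioOrTop, if_neg hB.ne', EReal.coe_lt_coe_iff] at hγ
    have hB' : (0 : ℝ) < B := by exact_mod_cast hB
    set ρ := (A : ℝ) / B with hρ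
    have hρ0 : 0 ≤ ρ := by positivity
    refine ⟨⌈ρ * (C / (γ - ρ)) + C⌉₊, fun m n hP hmn => ?_⟩
    have hn : (0 : ℝ) < n := by exact_mod_cast hP.pos
    rw [le_div_iff₀ hn] at hmn
    have h1 : (B : ℝ) * m ≤ A * n + B * C := by exact_mod_cast hup m n hP
    have h2 : (m : ℝ) ≤ ρ * n + C := by
      rw [hρ]
      have : (B : ℝ) * m ≤ B * (A / B * n + C) := by
        rw [mul_add, ← mul_assoc, mul_div_cancel₀ _ hB'.ne']
        exact h1
      exact le_of_mul_le_mul_left this hB'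
    have h3 : (n : ℝ) ≤ C / (γ - ρ) := by
      rw [le_div_iff₀ (by linarith)]
      nlinarith
    have h4 : (m : ℝ) ≤ ⌈ρ * (C / (γ - ρ)) + C⌉₊ :=
      le_trans (by nlinarith [mul_le_mul_of_nonneg_left h3 hρ0]) (Nat.le_ceil _)
    exact_mod_cast h4

theorem dio_eq_ratioOrTop (hA : 1 ≤ A)
    (hup : ∀ m n, DioPair a m n → B * m ≤ A * n + B * C)
    (hlow : ∃ c : ℤ, ∀ J : ℕ, ∃ m n : ℕ, J ≤ m ∧ DioPair a m n ∧ (B : ℤ) * m - A * n = c) :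
    Dio a = ratioOrTop A B := by
  apply le_antisymm
  · refine sSup_le ?_
    rintro _ ⟨β, hβ, rfl⟩
    by_contra hlt
    obtain ⟨K, hK⟩ := exists_forall_le_of_ratioOrTop_lt hup (not_le.1 hlt)
    obtain ⟨m, hm, n, hP, h⟩ := (hasDioExponent_iff a β).1 hβ (K + 1)
    have := hK m n hP h
    omega
  · refine le_of_forall_lt fun c hc => ?_
    obtain ⟨β, hcβ, hβ⟩ := EReal.lt_iff_exists_real_btwn.1 hc
    refine hcβ.trans_le (le_sSup ⟨β, (hasDioExponent_iff a β).2 fun N => ?_, rfl⟩)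
    obtain ⟨μ, ν, hμ, hP, hlim⟩ := exists_tendsto_ratioOrTop hA hlow
    obtain ⟨j, hj, hNj⟩ := ((hlim.eventually_const_lt hβ).and (eventually_ge_atTop N)).exists
    exact ⟨μ j, hNj.trans (hμ.id_le j), ν j, hP j, (EReal.coe_lt_coe_iff.1 hj).le⟩

theorem isGreatest_ratioOrTop {k : ℕ} [NeZero k] (hk : 2 ≤ k) (hA : 1 ≤ A)
    (hup : ∀ m n, DioPair a m n → B * m ≤ A * n + B * C)
    (hlow : ∃ c : ℤ, ∀ J : ℕ, ∃ m n : ℕ, J ≤ m ∧ DioPair a m n ∧ (B : ℤ) * m - A * n = c) :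
    IsGreatest {β : EReal | IsSpecialPoint (dioLanguage k a) β} (ratioOrTop A B) := by
  constructor
  · obtain ⟨μ, ν, hμ, hP, hlim⟩ := exists_tendsto_ratioOrTop hA hlow
    refine ⟨fun j => pairWord k (μ j) (ν j), fun i j hij => hμ.injective ?_, fun j =>
      ⟨mem_dioLanguage_iff.2 ⟨_, _, hP j, rfl⟩, ?_⟩, ?_⟩
    · have := congrArg (fun w => wordVal (w.map Prod.fst)) hij
      simpa only [wordVal_fst_pairWord hk] using this
    · rw [wordVal_snd_pairWord hk]
      have := (hP j).pos
      omega
    · simpa only [quo_pairWord hk] using hlim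
  · rintro β ⟨x, hx, hxL, hlim⟩
    by_contra hlt
    obtain ⟨γ, h1, h2⟩ := EReal.lt_iff_exists_real_btwn.1 (not_le.1 hlt)
    obtain ⟨K, hK⟩ := exists_forall_le_of_ratioOrTop_lt hup h1
    obtain ⟨J, hJ⟩ := eventually_atTop.1 (hlim.eventually_const_lt h2)
    -- A limit above the ratio would place infinitely many distinct words among the finitely many
    -- encodings of pairs bounded by `K`.
    have hfin : ((fun y : ℕ × ℕ => pairWord k y.1 y.2) ''
        (Set.Iic K ×ˢ Set.Iic K)).Finite :=
      ((Set.finite_Iic K).prod (Set.finite_Iic K)).image _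
    refine (Set.infinite_range_of_injective
      (hx.comp (add_left_injective J))).mono ?_ hfin
    rintro _ ⟨j, rfl⟩
    obtain ⟨m, n, hP, hw⟩ := mem_dioLanguage_iff.1 (hxL (j + J)).1
    have h3 := EReal.coe_lt_coe_iff.1 (hJ (j + J) (by omega))
    rw [hw, quo_pairWord hk] at h3
    have h4 := hK m n hP h3.le
    exact ⟨(m, n), ⟨h4, hP.1.trans h4⟩, hw.symm⟩

end Value

/-! ### The state map of an automatic sequence -/

section Kernel

variable {k : ℕ} [NeZero k]

/-- The state reached on reading `(n)_k`. -/
def DFAO.state {σ Δ : Type*} (M : DFAO k σ Δ) (n : ℕ) : σ :=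
  (natWord k n).foldl M.step M.start

theorem DFAO.state_zero {σ Δ : Type*} (M : DFAO k σ Δ) : M.state 0 = M.start := by
  simp [DFAO.state, natWord, padDigits]

theorem DFAO.state_of_pos {σ Δ : Type*} (M : DFAO k σ Δ) (hk : 2 ≤ k) {n : ℕ} (hn : 0 < n) :
    M.state n = M.step (M.state (n / k)) (Fin.ofNat k n) := by
  rw [DFAO.state, natWord, Nat.digits_def' (by omega) hn, List.length_cons, padDigits_succ,
    List.foldl_append]
  rfl

/-- Low-order digits act as a map on states. When `x₀ = 0` their leading zeros are not read, so the
state reached is recorded separately. Whatever `L` is, only finitely many labels `h` occur. -/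
theorem DFAO.exists_state_eq {σ Δ : Type*} (M : DFAO k σ Δ) (hk : 2 ≤ k) (L : ℕ) :
    ∀ x₁ < k ^ L, ∃ h : (σ → σ) × σ, ∀ x₀,
      M.state (k ^ L * x₀ + x₁) = if x₀ = 0 then h.2 else h.1 (M.state x₀) := by
  have hk0 : 0 < k := by omega
  induction L with
  | zero =>
    intro x₁ hx₁
    refine ⟨(id, M.start), fun x₀ => ?_⟩
    obtain rfl : x₁ = 0 := by simpa using hx₁
    split_ifs with h
    · simp [h, M.state_zero]
    · simp
  | succ L ih =>
    intro x₁ hx₁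
    obtain ⟨h, hh⟩ := ih (x₁ / k) (by rw [Nat.div_lt_iff_lt_mul hk0, ← pow_succ]; exact hx₁)
    refine ⟨(fun q => M.step (h.1 q) (Fin.ofNat k x₁), M.state x₁), fun x₀ => ?_⟩
    split_ifs with h0
    · simp [h0]
    · have e : k ^ (L + 1) * x₀ + x₁ = x₁ + k * (k ^ L * x₀) := by ring
      have hpos : 0 < k ^ (L + 1) * x₀ + x₁ := by positivity
      have e2 : (k ^ (L + 1) * x₀ + x₁) / k = k ^ L * x₀ + x₁ / k := by
        rw [e, Nat.add_mul_div_left _ _ hk0, add_comm]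
      have e3 : Fin.ofNat k (k ^ (L + 1) * x₀ + x₁) = Fin.ofNat k x₁ := by
        apply Fin.ext
        simp only [Fin.val_ofNat]
        rw [e, Nat.add_mul_mod_self_left]
      rw [M.state_of_pos hk hpos, e2, e3, hh, if_neg h0]

end Kernel

/-! ### Finitely many types of low-order digits -/

theorem mul_add_lt_mul_add_iff {K x₀ x₁ y₀ y₁ : ℕ} (hx : x₁ < K) (hy : y₁ < K) :
    K * x₀ + x₁ < K * y₀ + y₁ ↔ x₀ < y₀ + (decide (x₁ < y₁)).toNat := by
  rcases lt_trichotomy x₀ y₀ with h | rfl | h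
  · have : K * (x₀ + 1) ≤ K * y₀ := Nat.mul_le_mul_left _ h
    rw [Nat.mul_add_one] at this
    constructor <;> intro <;> omega
  · by_cases h : x₁ < y₁ <;> simp [h]
  · have : K * (y₀ + 1) ≤ K * x₀ := Nat.mul_le_mul_left _ h
    rw [Nat.mul_add_one] at this
    have := Bool.toNat_le (decide (x₁ < y₁))
    constructor <;> intro <;> omega

theorem dioPair_iff {Δ : Type*} {a : ℕ → Δ} {m n : ℕ} :
    DioPair a m n ↔ ¬ m < n ∧ ∃ i < n, ∀ x, ¬ x < n → x < m → a x = a (x + i - n) := by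
  rw [DioPair, not_lt]
  refine and_congr_right fun hnm => exists_congr fun i => and_congr_right fun hi => ?_
  constructor
  · intro h x hx hxm
    have := h (x - n) (by omega)
    rw [Nat.add_sub_cancel' (by omega)] at this
    rw [← this]
    congr 1
    omega
  · intro h j hj
    rw [h (n + j) (by omega) (by omega)]
    congr 1
    omega

section StateMap

variable {κ Δ : Type*}

/-- The comparison of two kernel sequences over a window: the conditions into which the equality of
two factors splits along the residues modulo a power of the base. -/
abbrev Comparison (κ : Type*) := κ × κ × Bool × Bool × Fin 3

/-- The comparison `ω` holds at `(m₀, n₀, i₀)`. -/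
def Comparison.Holds (F : κ → ℕ → Δ) (m₀ n₀ i₀ : ℕ) (ω : Comparison κ) : Prop :=
  ∀ x₀, ¬ x₀ < n₀ + ω.2.2.1.toNat → x₀ < m₀ + ω.2.2.2.1.toNat →
    F ω.1 x₀ = F ω.2.1 (x₀ + i₀ + ω.2.2.2.2.val - (n₀ + 1))

/-- The comparisons that arise from the low-order parts `r`, `t`, `c` of `m`, `n`, `i`. -/
def comparisons (k : ℕ) (τ : ℕ → ℕ → κ) (L r t c : ℕ) : Set (Comparison κ) :=
  {ω | ∃ x < k ^ L, ω = (τ L x, τ L ((x + c + k ^ L - t) % k ^ L), decide (x < t), decide (x < r),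
    Fin.ofNat 3 ((x + c + k ^ L - t) / k ^ L))}

/-- Split `x` by its residue `x₁` modulo `k ^ L`. Adding `i` and subtracting `n` acts on high parts
up to a carry, and on residues independently of `x₀`. Each residue contributes one comparison from a
finite set. -/
theorem forall_eq_iff_comparisons {k : ℕ} {a : ℕ → Δ} {F : κ → ℕ → Δ} {τ : ℕ → ℕ → κ}
    (hk : 2 ≤ k) (hτ : ∀ L, ∀ x₁ < k ^ L, ∀ x₀, a (k ^ L * x₀ + x₁) = F (τ L x₁) x₀)
    {L r t c : ℕ} (hr : r < k ^ L) (ht : t < k ^ L) (hc : c < k ^ L) (m₀ n₀ i₀ : ℕ) :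
    (∀ x, ¬ x < k ^ L * n₀ + t → x < k ^ L * m₀ + r →
        a x = a (x + (k ^ L * i₀ + c) - (k ^ L * n₀ + t))) ↔
      ∀ ω ∈ comparisons k τ L r t c, Comparison.Holds F m₀ n₀ i₀ ω := by
  have hK : 0 < k ^ L := by positivity
  have key : ∀ x₁ < k ^ L, ∀ x₀, ¬ k ^ L * x₀ + x₁ < k ^ L * n₀ + t →
      a (k ^ L * x₀ + x₁ + (k ^ L * i₀ + c) - (k ^ L * n₀ + t)) =
        F (τ L ((x₁ + c + k ^ L - t) % k ^ L))
          (x₀ + i₀ + (Fin.ofNat 3 ((x₁ + c + k ^ L - t) / k ^ L)).val - (n₀ + 1)) := by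
    intro x₁ hx₁ x₀ hx
    -- One `k ^ L` is borrowed to keep the residue nonnegative, whence the carry 0, 1 or 2 and the
    -- compensating `n₀ + 1`.
    have hlt : (x₁ + c + k ^ L - t) / k ^ L < 3 := by
      rw [Nat.div_lt_iff_lt_mul hK]
      omega
    rw [Fin.val_ofNat, Nat.mod_eq_of_lt hlt, ← hτ _ _ (Nat.mod_lt _ hK)]
    congr 1
    set e := (x₁ + c + k ^ L - t) / k ^ L
    set y := (x₁ + c + k ^ L - t) % k ^ L
    have hy : y < k ^ L := Nat.mod_lt _ hK
    have hey : k ^ L * e + y = x₁ + c + k ^ L - t := Nat.div_add_mod _ _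
    -- As `x ≥ n`, the truncated subtraction of high parts is a true one.
    have hge : n₀ + 1 ≤ x₀ + i₀ + e := by
      by_contra hcon
      have h1 : k ^ L * (x₀ + i₀ + e) ≤ k ^ L * n₀ := Nat.mul_le_mul_left _ (by omega)
      rw [Nat.mul_add, Nat.mul_add] at h1
      omega
    rw [Nat.mul_sub]
    have h2 := Nat.mul_le_mul_left (k ^ L) hge
    simp only [Nat.mul_add, Nat.mul_one] at h2 ⊢
    omega
  constructor
  · rintro h _ ⟨x₁, hx₁, rfl⟩ x₀ h1 h2
    simp only at h1 h2 ⊢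
    rw [← mul_add_lt_mul_add_iff hx₁ ht] at h1
    rw [← mul_add_lt_mul_add_iff hx₁ hr] at h2
    rw [← key x₁ hx₁ x₀ h1, ← hτ L x₁ hx₁ x₀]
    exact h _ h1 h2
  · intro h x h1 h2
    have hx₁ : x % k ^ L < k ^ L := Nat.mod_lt _ hK
    rw [← Nat.div_add_mod x (k ^ L)] at h1 h2 ⊢
    rw [key _ hx₁ _ h1, hτ _ _ hx₁]
    rw [mul_add_lt_mul_add_iff hx₁ ht] at h1
    rw [mul_add_lt_mul_add_iff hx₁ hr] at h2
    exact h _ ⟨x % k ^ L, hx₁, rfl⟩ _ h1 h2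

/-- What the low-order parts of `(m, n)` contribute to `DioPair`. -/
abbrev DigitType (κ : Type*) := Set (Set (Comparison κ)) × Set (Set (Comparison κ)) × Bool

/-- Low-order parts of type `T` put an extension of `(m₀, n₀)` into `DioPair`. -/
def DigitType.Accepts (F : κ → ℕ → Δ) (m₀ n₀ : ℕ) (T : DigitType κ) : Prop :=
  ¬ m₀ < n₀ + T.2.2.toNat ∧
    ((∃ i₀ < n₀, ∃ D ∈ T.1, ∀ ω ∈ D, Comparison.Holds F m₀ n₀ i₀ ω) ∨
      ∃ D ∈ T.2.1, ∀ ω ∈ D, Comparison.Holds F m₀ n₀ n₀ ω)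

/-- The type of the low-order parts `r`, `t`. -/
def digitType (k : ℕ) (τ : ℕ → ℕ → κ) (L r t : ℕ) : DigitType κ :=
  ({D | ∃ c < k ^ L, D = comparisons k τ L r t c}, {D | ∃ c < t, D = comparisons k τ L r t c},
    decide (r < t))

/-- The condition `i < n` means either a smaller high part with any low part, or equal high parts
with `c < t`; hence the two families in a `DigitType`. -/
theorem dioPair_iff_accepts {k : ℕ} {a : ℕ → Δ} {F : κ → ℕ → Δ} {τ : ℕ → ℕ → κ}
    (hk : 2 ≤ k) (hτ : ∀ L, ∀ x₁ < k ^ L, ∀ x₀, a (k ^ L * x₀ + x₁) = F (τ L x₁) x₀)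
    {L r t : ℕ} (hr : r < k ^ L) (ht : t < k ^ L) (m₀ n₀ : ℕ) :
    DioPair a (k ^ L * m₀ + r) (k ^ L * n₀ + t) ↔
      (digitType k τ L r t).Accepts F m₀ n₀ := by
  have hK : 0 < k ^ L := by positivity
  rw [dioPair_iff, DigitType.Accepts, mul_add_lt_mul_add_iff hr ht]
  refine and_congr_right fun _ => ?_
  constructor
  · rintro ⟨i, hi, h⟩
    have hc : i % k ^ L < k ^ L := Nat.mod_lt _ hK
    rw [← Nat.div_add_mod i (k ^ L)] at h hi
    rw [forall_eq_iff_comparisons hk hτ hr ht hc] at h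
    rw [mul_add_lt_mul_add_iff hc ht] at hi
    rcases lt_or_ge (i / k ^ L) n₀ with hlt | hge
    · exact Or.inl ⟨_, hlt, _, ⟨_, hc, rfl⟩, h⟩
    · by_cases hct : i % k ^ L < t
      · simp only [hct, decide_true, Bool.toNat_true] at hi
        obtain rfl : i / k ^ L = n₀ := by omega
        exact Or.inr ⟨_, ⟨_, hct, rfl⟩, h⟩
      · simp only [hct, decide_false, Bool.toNat_false] at hi
        omega
  · rintro (⟨i₀, hi₀, _, ⟨c, hc, rfl⟩, h⟩ | ⟨_, ⟨c, hc, rfl⟩, h⟩)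
    · exact ⟨k ^ L * i₀ + c, (mul_add_lt_mul_add_iff hc ht).2 (by omega),
        (forall_eq_iff_comparisons hk hτ hr ht hc _ _ _).2 h⟩
    · exact ⟨k ^ L * n₀ + c, by omega,
        (forall_eq_iff_comparisons hk hτ hr ht (hc.trans ht) _ _ _).2 h⟩

/-- The state of a prefix is the set of all digit types it accepts. The types form one finite set
for all `L` when `κ` is finite. -/
theorem pairSystem_dioPair {k : ℕ} {a : ℕ → Δ} {F : κ → ℕ → Δ} {τ : ℕ → ℕ → κ}
    (hk : 2 ≤ k) (hτ : ∀ L, ∀ x₁ < k ^ L, ∀ x₀, a (k ^ L * x₀ + x₁) = F (τ L x₁) x₀) :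
    PairSystem k (DioPair a) (fun m₀ n₀ => {T : DigitType κ | T.Accepts F m₀ n₀}) where
  congr {m n m' n'} h {L r t} hr ht := by
    rw [dioPair_iff_accepts hk hτ hr ht, dioPair_iff_accepts hk hτ hr ht]
    exact Set.ext_iff.1 h (digitType k τ L r t)
  pos h := h.pos
  le h := h.1
  diag h := DioPair.diag a h

end StateMap

/-- A number of states that suffices for the pairs `DioPair` of the sequence generated by an
automaton with `s` states. -/
def stateBound (s : ℕ) : ℕ :=
  -- `s ^ s * s` counts the labels in `(σ → σ) × σ`, and 12 = 2 · 2 · 3 the two flags and the carry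
  -- of a comparison.
  2 ^ (2 ^ 2 ^ ((s ^ s * s) * ((s ^ s * s) * 12)) *
    (2 ^ 2 ^ ((s ^ s * s) * ((s ^ s * s) * 12)) * 2))

theorem DFAO.exists_pairSystem {k : ℕ} [NeZero k] {σ : Type} [Fintype σ] {Δ : Type*}
    (M : DFAO k σ Δ) (hk : 2 ≤ k) :
    ∃ (S : Type) (_ : Fintype S) (St : ℕ → ℕ → S), PairSystem k (DioPair M.seq) St ∧
      Fintype.card S = stateBound (Fintype.card σ) := by
  classical
  have h : ∀ L x₁, ∃ h : (σ → σ) × σ, x₁ < k ^ L → ∀ x₀,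
      M.state (k ^ L * x₀ + x₁) = if x₀ = 0 then h.2 else h.1 (M.state x₀) := by
    intro L x₁
    by_cases hx : x₁ < k ^ L
    · obtain ⟨h, hh⟩ := M.exists_state_eq hk L x₁ hx
      exact ⟨h, fun _ => hh⟩
    · exact ⟨(id, M.start), fun h => absurd h hx⟩
  choose τ hτ using h
  refine ⟨Set (DigitType ((σ → σ) × σ)), inferInstance, _,
    pairSystem_dioPair (F := fun h x₀ => M.out (if x₀ = 0 then h.2 else h.1 (M.state x₀)))
      (τ := τ) hk fun L x₁ hx₁ x₀ => ?_, ?_⟩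
  · rw [← hτ L x₁ hx₁ x₀]
    rfl
  · simp [stateBound, Fintype.card_set, Fintype.card_prod]

/-! ### Regularity -/

section Regular

variable {k : ℕ} [NeZero k]

theorem length_pairWord (m n : ℕ) :
    (pairWord k m n).length = max (Nat.digits k m).length (Nat.digits k n).length := by
  simp [pairWord, length_padDigits]

/-- The word is the canonical encoding of a pair of integers. -/
def IsCanonical (w : List (Fin k × Fin k)) : Prop :=
  w = [] ∨ k ^ (w.length - 1) ≤ wordVal (w.map Prod.fst) ∨
    k ^ (w.length - 1) ≤ wordVal (w.map Prod.snd)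

theorem isCanonical_pairWord (hk : 2 ≤ k) (m n : ℕ) : IsCanonical (pairWord k m n) := by
  rcases Nat.eq_zero_or_pos (pairWord k m n).length with h | h
  · exact Or.inl (List.length_eq_zero_iff.1 h)
  · refine Or.inr ?_
    rw [wordVal_fst_pairWord hk, wordVal_snd_pairWord hk]
    rw [length_pairWord] at h ⊢
    rw [← Nat.lt_digits_length_iff (by omega), ← Nat.lt_digits_length_iff (by omega)]
    rcases max_choice (Nat.digits k m).length (Nat.digits k n).length with h' | h' <;>
      rw [h'] at h ⊢ <;> omega

theorem IsCanonical.eq_pairWord (hk : 2 ≤ k) {w : List (Fin k × Fin k)} (h : IsCanonical w) :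
    w = pairWord k (wordVal (w.map Prod.fst)) (wordVal (w.map Prod.snd)) := by
  rcases h with rfl | h
  · simp [pairWord, wordVal, padDigits]
  · have h1 := wordVal_lt (w.map Prod.fst)
    have h2 := wordVal_lt (w.map Prod.snd)
    rw [List.length_map, ← Nat.digits_length_le_iff (by omega)] at h1 h2
    rw [← Nat.lt_digits_length_iff (by omega), ← Nat.lt_digits_length_iff (by omega)] at h
    have hmax : max (Nat.digits k (wordVal (w.map Prod.fst))).length
        (Nat.digits k (wordVal (w.map Prod.snd))).length = w.length := by
      omega
    have e1 := padDigits_wordVal (w.map Prod.fst)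
    have e2 := padDigits_wordVal (w.map Prod.snd)
    rw [List.length_map] at e1 e2
    rw [pairWord, hmax, e1, e2, List.zip_map', List.map_id']

theorem mem_dioLanguage_iff_isCanonical (hk : 2 ≤ k) {Δ : Type*} {a : ℕ → Δ}
    {w : List (Fin k × Fin k)} :
    w ∈ dioLanguage k a ↔
      IsCanonical w ∧ DioPair a (wordVal (w.map Prod.fst)) (wordVal (w.map Prod.snd)) := by
  rw [mem_dioLanguage_iff]
  constructor
  · rintro ⟨m, n, h, rfl⟩
    rw [wordVal_fst_pairWord hk, wordVal_snd_pairWord hk]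
    exact ⟨isCanonical_pairWord hk m n, h⟩
  · rintro ⟨hw, h⟩
    exact ⟨_, _, h, hw.eq_pairWord hk⟩

/-- For a nonempty word, being canonical only says that the first letter is not (0, 0). -/
theorem isCanonical_append_iff {k : ℕ} (hk : 2 ≤ k) {w : List (Fin k × Fin k)} (hw : w ≠ [])
    (z : List (Fin k × Fin k)) : IsCanonical (w ++ z) ↔ IsCanonical w := by
  have hl : 0 < w.length := List.length_pos_iff.2 hw
  have key : ∀ p : Fin k × Fin k → Fin k,
      k ^ ((w ++ z).length - 1) ≤ wordVal ((w ++ z).map p) ↔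
        k ^ (w.length - 1) ≤ wordVal (w.map p) := by
    intro p
    have hz := wordVal_lt (z.map p)
    rw [List.length_map] at hz
    rw [List.map_append, wordVal_append, List.length_map, List.length_append,
      Nat.sub_add_comm hl, pow_add, mul_comm (k ^ (w.length - 1)), mul_comm (wordVal (w.map p))]
    rw [← not_lt, ← not_lt, not_iff_not]
    have := mul_add_lt_mul_add_iff (x₀ := wordVal (w.map p)) (y₀ := k ^ (w.length - 1)) hz
      (show 0 < k ^ z.length by positivity)
    simpa using this
  rw [IsCanonical, IsCanonical, key, key]
  simp [hw]

/-- The left quotient by a nonempty canonical word depends only on the state of the pair it encodes;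
by a noncanonical word it is empty. -/
theorem isRegular_dioLanguage (hk : 2 ≤ k) {Δ : Type*} {a : ℕ → Δ} {S : Type*} [Finite S]
    {St : ℕ → ℕ → S} (hS : PairSystem k (DioPair a) St) : (dioLanguage k a).IsRegular := by
  apply Language.IsRegular.of_finite_range_leftQuotient
  let ext : ℕ → ℕ → Language (Fin k × Fin k) := fun m n =>
    {z | DioPair a (k ^ z.length * m + wordVal (z.map Prod.fst))
      (k ^ z.length * n + wordVal (z.map Prod.snd))}
  have hext : ∀ {m n m' n'}, St m n = St m' n' → ext m n = ext m' n' := by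
    intro m n m' n' h
    ext z
    have h1 := wordVal_lt (z.map Prod.fst)
    have h2 := wordVal_lt (z.map Prod.snd)
    rw [List.length_map] at h1 h2
    exact hS.congr h h1 h2
  have hfin : (Set.range fun x : ℕ × ℕ => ext x.1 x.2).Finite := by
    refine (Set.finite_range fun s : S => {z | ∃ m n, St m n = s ∧ z ∈ ext m n}).subset ?_
    rintro _ ⟨⟨m, n⟩, rfl⟩
    refine ⟨St m n, ?_⟩
    ext z
    constructor
    · rintro ⟨m', n', h, hz⟩
      exact (hext h ▸ hz : z ∈ ext m n)
    · exact fun hz => ⟨m, n, rfl, hz⟩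
  refine ((hfin.insert (∅ : Set (List (Fin k × Fin k)))).insert (dioLanguage k a)).subset ?_
  rintro _ ⟨w, rfl⟩
  rcases eq_or_ne w [] with rfl | hw
  · exact Or.inl rfl
  · by_cases hc : IsCanonical w
    · refine Or.inr (Or.inr ⟨(wordVal (w.map Prod.fst), wordVal (w.map Prod.snd)), ?_⟩)
      ext z
      rw [Language.mem_leftQuotient, mem_dioLanguage_iff_isCanonical hk,
        isCanonical_append_iff hk hw, and_iff_right hc, List.map_append, List.map_append,
        wordVal_append, wordVal_append, List.length_map, List.length_map, mul_comm,
        mul_comm (wordVal (w.map Prod.snd))]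
      rfl
    · refine Or.inr (Or.inl ?_)
      refine Set.eq_empty_iff_forall_notMem.2 fun z hz => hc ?_
      exact (isCanonical_append_iff hk hw z).1 ((mem_dioLanguage_iff_isCanonical hk).1 hz).1

end Regular

/-! ### The algorithm -/

/-- The finite description of an automaton with output. -/
abbrev DFAOCode := ℕ × List (List ℕ) × ℕ × List ℕ

namespace DFAOCode

/-- The step from the state `q` on the `i`-th digit of `n`, where leading zeros are ignored. -/
def next (c : DFAOCode) (n i q : ℕ) : ℕ :=
  if n / c.1 ^ (n - i) = 0 then c.2.2.1 else
    (c.2.1.getD q []).getD (n / c.1 ^ (n - i) % c.1) 0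

/-- The state, after `i` steps, of the automaton described by `c` reading `n`. -/
def run (c : DFAOCode) (n : ℕ) : ℕ → ℕ
  | 0 => c.2.2.1
  | i + 1 => c.next n i (run c n i)

/-- The sequence generated by the automaton described by `c`. -/
def seq (c : DFAOCode) (n : ℕ) : ℕ :=
  c.2.2.2.getD (c.run n (n + 1)) 0

/-- A bound for the numerator and denominator of the exponent. -/
def valueBound (c : DFAOCode) : ℕ := c.1 ^ (stateBound c.2.1.length + 1)

/-- A multiple of the denominator of the exponent. -/
def denominator (c : DFAOCode) : ℕ := c.valueBound.factorial

/-- No pair below the search bound shows that the exponent exceeds `p / c.denominator`. -/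
def Passes (c : DFAOCode) (p : ℕ) : Prop :=
  ∀ m < PairSystem.searchBound c.valueBound p c.denominator,
    ∀ n < PairSystem.searchBound c.valueBound p c.denominator,
      ¬ DioPair c.seq m n ∨ c.denominator * m ≤ p * n + c.denominator * c.valueBound

open Classical in
/-- The algorithm that computes the Diophantine exponent. -/
noncomputable def dioAlgorithm (c : DFAOCode) : Option (ℕ × ℕ) :=
  -- For the code of an automaton, the failing `p` form an initial segment. Any finite exponent
  -- passes at `valueBound * denominator`, so failure there means ∞.
  if Nat.findGreatest (fun p => ¬ c.Passes p) (c.valueBound * c.denominator) =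
      c.valueBound * c.denominator then none
  else some (Nat.findGreatest (fun p => ¬ c.Passes p) (c.valueBound * c.denominator) + 1,
    c.denominator)

/-! ### Computability of the algorithm -/

theorem primrecPred_forall_lt {α : Type*} [Primcodable α] {f : α → ℕ} {R : ℕ → α → Prop}
    (hf : Primrec f) (hR : PrimrecRel R) : PrimrecPred fun a => ∀ x < f a, R x a :=
  (hR.forall_mem_list.comp (Primrec.list_range.comp hf) Primrec.id).of_eq (by simp)

theorem primrecPred_exists_lt {α : Type*} [Primcodable α] {f : α → ℕ} {R : ℕ → α → Prop}
    (hf : Primrec f) (hR : PrimrecRel R) : PrimrecPred fun a => ∃ x < f a, R x a :=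
  (hR.exists_mem_list.comp (Primrec.list_range.comp hf) Primrec.id).of_eq (by simp)

theorem primrec_pow : Primrec₂ ((· ^ ·) : ℕ → ℕ → ℕ) :=
  Primrec₂.unpaired'.1 Nat.Primrec.pow

theorem primrec_factorial : Primrec Nat.factorial :=
  (Primrec.nat_rec₁ (f := fun n r => (n + 1) * r) 1
    (Primrec.nat_mul.comp (Primrec.succ.comp Primrec.fst) Primrec.snd)).of_eq fun n => by
      induction n with
      | zero => rfl
      | succ n ih => rw [Nat.factorial_succ, ← ih]

theorem primrec_stateBound : Primrec stateBound := by
  have two : ∀ {f : ℕ → ℕ}, Primrec f → Primrec fun s => 2 ^ f s := fun hf =>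
    primrec_pow.comp (Primrec.const 2) hf
  have h : Primrec fun s : ℕ => s ^ s * s :=
    Primrec.nat_mul.comp (primrec_pow.comp Primrec.id Primrec.id) Primrec.id
  have h' : Primrec fun s : ℕ => 2 ^ 2 ^ ((s ^ s * s) * ((s ^ s * s) * 12)) :=
    two (two (Primrec.nat_mul.comp h (Primrec.nat_mul.comp h (Primrec.const 12))))
  exact two (Primrec.nat_mul.comp h' (Primrec.nat_mul.comp h' (Primrec.const 2)))

theorem primrec_searchBound : Primrec fun x : ℕ × ℕ × ℕ =>
    PairSystem.searchBound x.1 x.2.1 x.2.2 := by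
  have hC : Primrec fun x : ℕ × ℕ × ℕ => x.1 := Primrec.fst
  have hp : Primrec fun x : ℕ × ℕ × ℕ => x.2.1 := Primrec.fst.comp Primrec.snd
  have hq : Primrec fun x : ℕ × ℕ × ℕ => x.2.2 := Primrec.snd.comp Primrec.snd
  have hj := Primrec.succ.comp (Primrec.nat_add.comp (Primrec.nat_mul.comp hp hC)
    (Primrec.nat_mul.comp hq hC))
  exact Primrec.nat_add.comp (Primrec.nat_mul.comp hC (Primrec.nat_add.comp hC
    (Primrec.nat_mul.comp hC (primrec_pow.comp hC hj)))) hC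

theorem primrec_next : Primrec fun x : DFAOCode × ℕ × ℕ × ℕ => x.1.next x.2.1 x.2.2.1 x.2.2.2 := by
  have hn : Primrec fun x : DFAOCode × ℕ × ℕ × ℕ => x.2.1 := Primrec.fst.comp Primrec.snd
  have hk : Primrec fun x : DFAOCode × ℕ × ℕ × ℕ => x.1.1 := Primrec.fst.comp Primrec.fst
  have hstart : Primrec fun x : DFAOCode × ℕ × ℕ × ℕ => x.1.2.2.1 :=
    Primrec.fst.comp (Primrec.snd.comp (Primrec.snd.comp Primrec.fst))
  have htab : Primrec fun x : DFAOCode × ℕ × ℕ × ℕ => x.1.2.1 :=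
    Primrec.fst.comp (Primrec.snd.comp Primrec.fst)
  have hi : Primrec fun x : DFAOCode × ℕ × ℕ × ℕ => x.2.2.1 :=
    Primrec.fst.comp (Primrec.snd.comp Primrec.snd)
  have hq : Primrec fun x : DFAOCode × ℕ × ℕ × ℕ => x.2.2.2 :=
    Primrec.snd.comp (Primrec.snd.comp Primrec.snd)
  have hdiv : Primrec fun x : DFAOCode × ℕ × ℕ × ℕ => x.2.1 / x.1.1 ^ (x.2.1 - x.2.2.1) :=
    Primrec.nat_div.comp hn (primrec_pow.comp hk (Primrec.nat_sub.comp hn hi))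
  have hrow : Primrec fun x : DFAOCode × ℕ × ℕ × ℕ => x.1.2.1.getD x.2.2.2 [] :=
    (Primrec.list_getD ([] : List ℕ)).comp htab hq
  exact Primrec.ite (Primrec.eq.comp hdiv (Primrec.const 0)) hstart
    ((Primrec.list_getD 0).comp hrow (Primrec.nat_mod.comp hdiv hk))

theorem primrec_run : Primrec fun x : DFAOCode × ℕ × ℕ => x.1.run x.2.1 x.2.2 := by
  have hstart : Primrec fun x : DFAOCode × ℕ × ℕ => x.1.2.2.1 :=
    Primrec.fst.comp (Primrec.snd.comp (Primrec.snd.comp Primrec.fst))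
  have hnext : Primrec₂ fun (x : DFAOCode × ℕ × ℕ) (y : ℕ × ℕ) => x.1.next x.2.1 y.1 y.2 :=
    primrec_next.comp ((Primrec.fst.comp Primrec.fst).pair
      ((Primrec.fst.comp (Primrec.snd.comp Primrec.fst)).pair Primrec.snd))
  refine (Primrec.nat_rec' (Primrec.snd.comp Primrec.snd) hstart hnext).of_eq fun x => ?_
  obtain ⟨c, n, i⟩ := x
  induction i with
  | zero => rfl
  | succ i ih => exact congrArg (c.next n i) ih

theorem primrec_seq : Primrec₂ DFAOCode.seq := by
  have hout : Primrec fun x : DFAOCode × ℕ => x.1.2.2.2 :=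
    Primrec.snd.comp (Primrec.snd.comp (Primrec.snd.comp Primrec.fst))
  exact (Primrec.list_getD 0).comp hout (primrec_run.comp (Primrec.fst.pair
    (Primrec.snd.pair (Primrec.succ.comp Primrec.snd))))

theorem primrecPred_dioPair : PrimrecPred fun x : DFAOCode × ℕ × ℕ =>
    DioPair x.1.seq x.2.1 x.2.2 := by
  have hm : Primrec fun x : DFAOCode × ℕ × ℕ => x.2.1 := Primrec.fst.comp Primrec.snd
  have hn : Primrec fun x : DFAOCode × ℕ × ℕ => x.2.2 := Primrec.snd.comp Primrec.snd
  have h1 : PrimrecRel fun (j : ℕ) (y : ℕ × DFAOCode × ℕ × ℕ) =>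
      y.2.1.seq (y.1 + j) = y.2.1.seq (y.2.2.2 + j) := by
    have hc : Primrec fun z : ℕ × ℕ × DFAOCode × ℕ × ℕ => z.2.2.1 :=
      Primrec.fst.comp (Primrec.snd.comp Primrec.snd)
    exact Primrec.eq.comp
      (primrec_seq.comp hc (Primrec.nat_add.comp (Primrec.fst.comp Primrec.snd) Primrec.fst))
      (primrec_seq.comp hc (Primrec.nat_add.comp
        (hn.comp (Primrec.snd.comp Primrec.snd)) Primrec.fst))
  have h2 : PrimrecRel fun (i : ℕ) (x : DFAOCode × ℕ × ℕ) =>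
      ∀ j < x.2.1 - x.2.2, x.1.seq (i + j) = x.1.seq (x.2.2 + j) :=
    primrecPred_forall_lt
      (Primrec.nat_sub.comp (hm.comp Primrec.snd) (hn.comp Primrec.snd)) h1
  exact (Primrec.nat_le.comp hn hm).and (primrecPred_exists_lt hn h2)

theorem primrec_valueBound : Primrec valueBound :=
  primrec_pow.comp Primrec.fst (Primrec.succ.comp (primrec_stateBound.comp
    (Primrec.list_length.comp (Primrec.fst.comp Primrec.snd))))

theorem primrec_denominator : Primrec denominator :=
  primrec_factorial.comp primrec_valueBound

theorem primrecRel_passes : PrimrecRel Passes := by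
  have hW : Primrec fun x : DFAOCode × ℕ =>
      PairSystem.searchBound x.1.valueBound x.2 x.1.denominator :=
    primrec_searchBound.comp ((primrec_valueBound.comp Primrec.fst).pair
      (Primrec.snd.pair (primrec_denominator.comp Primrec.fst)))
  have h1 : PrimrecRel fun (n : ℕ) (y : ℕ × DFAOCode × ℕ) =>
      ¬ DioPair y.2.1.seq y.1 n ∨ y.2.1.denominator * y.1 ≤
        y.2.2 * n + y.2.1.denominator * y.2.1.valueBound := by
    have hn : Primrec fun z : ℕ × ℕ × DFAOCode × ℕ => z.1 := Primrec.fst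
    have hm : Primrec fun z : ℕ × ℕ × DFAOCode × ℕ => z.2.1 := Primrec.fst.comp Primrec.snd
    have hc : Primrec fun z : ℕ × ℕ × DFAOCode × ℕ => z.2.2.1 :=
      Primrec.fst.comp (Primrec.snd.comp Primrec.snd)
    have hp : Primrec fun z : ℕ × ℕ × DFAOCode × ℕ => z.2.2.2 :=
      Primrec.snd.comp (Primrec.snd.comp Primrec.snd)
    have hD := primrec_denominator.comp hc
    exact (primrecPred_dioPair.comp (hc.pair (hm.pair hn))).not.or
      (Primrec.nat_le.comp (Primrec.nat_mul.comp hD hm) (Primrec.nat_add.comp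
        (Primrec.nat_mul.comp hp hn) (Primrec.nat_mul.comp hD (primrec_valueBound.comp hc))))
  have h2 : PrimrecRel fun (m : ℕ) (x : DFAOCode × ℕ) =>
      ∀ n < PairSystem.searchBound x.1.valueBound x.2 x.1.denominator,
        ¬ DioPair x.1.seq m n ∨ x.1.denominator * m ≤
          x.2 * n + x.1.denominator * x.1.valueBound :=
    primrecPred_forall_lt (hW.comp Primrec.snd) h1
  exact primrecPred_forall_lt hW h2

theorem computable_dioAlgorithm : Computable dioAlgorithm := by
  classical
  have hb : Primrec fun c : DFAOCode => c.valueBound * c.denominator :=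
    Primrec.nat_mul.comp primrec_valueBound primrec_denominator
  have hg : Primrec fun c : DFAOCode =>
      Nat.findGreatest (fun p => ¬ c.Passes p) (c.valueBound * c.denominator) :=
    Primrec.nat_findGreatest hb primrecRel_passes.not
  have h : Primrec dioAlgorithm := Primrec.ite (Primrec.eq.comp hg hb) (Primrec.const none)
    (Primrec.option_some.comp ((Primrec.succ.comp hg).pair primrec_denominator))
  exact h.to_comp

/-! ### Correctness of the algorithm -/

/-- As `n < k ^ n`, starting at digit position `n` passes over all digits, so the number of digits
need not be computed. -/
theorem run_code {k : ℕ} [NeZero k] (hk : 2 ≤ k) {s : ℕ} (M : DFAO k (Fin s) ℕ) (n i : ℕ)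
    (hi : i ≤ n) : DFAOCode.run M.code n (i + 1) = (M.state (n / k ^ (n - i))).val := by
  induction i with
  | zero =>
    have h0 : n / k ^ (n - 0) = 0 := Nat.div_eq_of_lt (Nat.lt_pow_self (by omega))
    have : DFAOCode.run M.code n (0 + 1) = M.start.val := by
      change (if n / k ^ (n - 0) = 0 then _ else _) = _
      rw [if_pos h0]
      rfl
    rw [this, h0, M.state_zero]
  | succ i ih =>
    have hd : n / k ^ (n - (i + 1)) / k = n / k ^ (n - i) := by
      rw [Nat.div_div_eq_div_mul, ← pow_succ]
      congr 2
      omega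
    have hrec : DFAOCode.run M.code n (i + 1 + 1) =
        if n / k ^ (n - (i + 1)) = 0 then M.start.val else
          ((DFAO.code M).2.1.getD (DFAOCode.run M.code n (i + 1)) []).getD
            (n / k ^ (n - (i + 1)) % k) 0 := rfl
    rw [hrec, ih (by omega)]
    split_ifs with h0
    · rw [h0, M.state_zero]
    · rw [M.state_of_pos hk (Nat.pos_of_ne_zero h0), hd]
      have hlt : n / k ^ (n - (i + 1)) % k < k := Nat.mod_lt _ (by omega)
      simp [DFAO.code, List.getD_eq_getElem?_getD, hlt, Fin.ofNat]

theorem seq_code {k : ℕ} [NeZero k] (hk : 2 ≤ k) {s : ℕ} (M : DFAO k (Fin s) ℕ) :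
    DFAOCode.seq M.code = M.seq := by
  funext n
  rw [DFAOCode.seq, run_code hk M n n le_rfl]
  simp [DFAO.code, List.getD_eq_getElem?_getD, DFAO.seq, DFAO.state]

theorem valueBound_code {k s : ℕ} (M : DFAO k (Fin s) ℕ) :
    valueBound M.code = k ^ (stateBound s + 1) := by
  simp [valueBound, DFAO.code]

end DFAOCode

/-! ### Assembly of the value, the bounds and the algorithm -/

/-- The exponent as the ratio of a loop, with the bounds that make it computable. -/
theorem PairSystem.exists_ratio {k : ℕ} (hk : 2 ≤ k) {Δ : Type*} {a : ℕ → Δ} {S : Type*}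
    [Fintype S] {St : ℕ → ℕ → S} (hS : PairSystem k (DioPair a) St) :
    ∃ A B : ℕ, 1 ≤ A ∧ A ≤ k ^ (Fintype.card S + 1) ∧ B ≤ k ^ (Fintype.card S + 1) ∧
      (∀ m n, DioPair a m n → B * m ≤ A * n + B * k ^ (Fintype.card S + 1)) ∧
      (∃ c : ℤ, ∀ J : ℕ, ∃ m n : ℕ, J ≤ m ∧ DioPair a m n ∧ (B : ℤ) * m - A * n = c) ∧
      ∀ p q, p * B < q * A → ∃ m n, DioPair a m n ∧
        m < searchBound (k ^ (Fintype.card S + 1)) p q ∧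
        p * n + q * k ^ (Fintype.card S + 1) < q * m := by
  obtain ⟨m₀, n₀, A, B, l, hl, hs, hmax⟩ := hS.exists_max_loop hk
  have := hS.loop_le hl
  exact ⟨A, B, hl.one_le hk, by omega, by omega,
    fun m n h => hS.mul_le_of_forall_loop hk hmax h, hS.exists_pumped hk hl,
    fun p q h => hS.exists_bounded_violation hk hl hs h⟩

theorem denotes_dioAlgorithm {k : ℕ} [NeZero k] (hk : 2 ≤ k) {s : ℕ} (M : DFAO k (Fin s) ℕ) :
    Denotes (DFAOCode.dioAlgorithm M.code) (Dio M.seq) := by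
  classical
  obtain ⟨S, _, St, hS, hcard⟩ := M.exists_pairSystem hk
  obtain ⟨A, B, hA, hAC, hBC, hup, hlow, hviol⟩ := hS.exists_ratio hk
  rw [dio_eq_ratioOrTop hA hup hlow]
  rw [hcard, Fintype.card_fin, ← DFAOCode.valueBound_code M] at hAC hBC hup hviol
  set C := DFAOCode.valueBound M.code with hC
  set D := DFAOCode.denominator M.code with hD
  have hD0 : 0 < D := Nat.factorial_pos _
  -- Passing the finite search is equivalent to `A / B ≤ p / D` with `B` nonzero.
  have hpass : ∀ p, DFAOCode.Passes M.code p ↔ 1 ≤ B ∧ D * A ≤ p * B := by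
    intro p
    rw [DFAOCode.Passes, DFAOCode.seq_code hk]
    constructor
    · intro h
      have h1 : D * A ≤ p * B := by
        by_contra hlt
        obtain ⟨m, n, hP, hm, hlt'⟩ := hviol p D (not_le.1 hlt)
        rcases h m hm n (hP.1.trans_lt hm) with h' | h'
        · exact h' hP
        · exact absurd h' (not_le.2 hlt')
      refine ⟨Nat.pos_of_ne_zero ?_, h1⟩
      rintro rfl
      have := Nat.mul_pos hD0 hA
      omega
    · rintro ⟨hB, h⟩ m - n -
      by_cases hP : DioPair M.seq m n
      · refine Or.inr ?_
        have h1 := Nat.mul_le_mul_left D (hup m n hP)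
        have h2 := Nat.mul_le_mul_right n h
        refine Nat.le_of_mul_le_mul_left (?_ : B * _ ≤ B * _) hB
        nlinarith
      · exact Or.inl hP
  rw [DFAOCode.dioAlgorithm, ← hC, ← hD]
  rcases Nat.eq_zero_or_pos B with hB | hB
  · have hg : Nat.findGreatest (fun p => ¬ DFAOCode.Passes M.code p) (C * D) = C * D :=
      le_antisymm (Nat.findGreatest_le _) (Nat.le_findGreatest le_rfl (by rw [hpass]; omega))
    rw [if_pos hg]
    exact Or.inl ⟨rfl, by rw [ratioOrTop, if_pos hB]⟩
  -- Since `B ≤ C` divides `D = C!`, the value is `A * D' / D`, and `A * D'` is the least passing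
  -- numerator, one more than the greatest failing one.
  · obtain ⟨D', hD'⟩ : B ∣ D := Nat.dvd_factorial hB hBC
    have hD'0 : 0 < D' := Nat.pos_of_ne_zero (by rintro rfl; omega)
    have hp0 : 0 < A * D' := Nat.mul_pos hA hD'0
    have hle : A * D' ≤ C * D :=
      Nat.mul_le_mul hAC (by rw [hD']; exact Nat.le_mul_of_pos_left _ hB)
    have hpass' : ∀ p, DFAOCode.Passes M.code p ↔ A * D' ≤ p := by
      intro p
      rw [hpass, and_iff_right (show 1 ≤ B from hB), hD',
        show B * D' * A = A * D' * B by ring, Nat.mul_le_mul_right_iff hB]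
    have hfail : ¬ DFAOCode.Passes M.code (A * D' - 1) := by rw [hpass']; omega
    have h1 := Nat.le_findGreatest (P := fun p => ¬ DFAOCode.Passes M.code p)
      (show A * D' - 1 ≤ C * D by omega) hfail
    have h2 := Nat.findGreatest_spec (P := fun p => ¬ DFAOCode.Passes M.code p)
      (show A * D' - 1 ≤ C * D by omega) hfail
    rw [hpass'] at h2
    have hg : Nat.findGreatest (fun p => ¬ DFAOCode.Passes M.code p) (C * D) = A * D' - 1 := by
      omega
    rw [hg, if_neg (by omega), Nat.sub_add_cancel hp0]
    refine Or.inr ⟨_, _, rfl, hD0, ?_⟩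
    rw [ratioOrTop, if_neg hB.ne', hD']
    push_cast
    rw [mul_div_mul_right _ _ (by exact_mod_cast hD'0.ne')]

theorem mainTheorem9 :
    (∀ (k : ℕ) [NeZero k], 2 ≤ k → ∀ {Δ : Type*} [Finite Δ] (a : ℕ → Δ), IsAutomatic k a →
      ((∃ r : ℚ, Dio a = ((r : ℝ) : EReal)) ∨ Dio a = ⊤) ∧
      (dioLanguage k a).IsRegular ∧
      IsGreatest {β : EReal | IsSpecialPoint (dioLanguage k a) β} (Dio a)) ∧
    (∃ f : ℕ × List (List ℕ) × ℕ × List ℕ → Option (ℕ × ℕ), Computable f ∧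
      ∀ (k : ℕ) [NeZero k], 2 ≤ k → ∀ (s : ℕ) (M : DFAO k (Fin s) ℕ),
        Denotes (f M.code) (Dio M.seq)) := by
  refine ⟨?_, DFAOCode.dioAlgorithm, DFAOCode.computable_dioAlgorithm,
    fun k _ hk s M => denotes_dioAlgorithm hk M⟩
  rintro k _ hk Δ _ a ⟨σ, _, M, rfl⟩
  obtain ⟨S, _, St, hS, -⟩ := M.exists_pairSystem hk
  obtain ⟨A, B, hA, -, -, hup, hlow, -⟩ := hS.exists_ratio hk
  rw [dio_eq_ratioOrTop hA hup hlow]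
  refine ⟨?_, isRegular_dioLanguage hk hS, isGreatest_ratioOrTop hk hA hup hlow⟩
  rw [ratioOrTop]
  split_ifs with hB
  · exact Or.inr rfl
  · exact Or.inl ⟨(A : ℚ) / B, by push_cast; rfl⟩
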